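/- **Theorem (unbounded Stinespring theorem).** Inner products are linear in the first variable. Let $\mathcal B$ be a C*-algebra with multiplier algebra $M(\mathcal B)$, let $(p_k)_{k\in\mathbb N}\subseteq M(\mathcal B)$ be an increasing sequence of projections, and let $\mathcal A\subseteq\mathcal B$ be a dense $*$-subalgebra with $p_n\mathcal A\subseteq\mathcal A$ and $\mathcal A p_n\subseteq\mathcal A$ for all $n$ and $\mathcal A=\bigcup_{k}p_k\mathcal A p_k$. Let $H$ be a complex Hilbert space, let $(q_k)_{k\in\mathbb N}$ be an increasing sequence of orthogonal projections on $H$ converging strongly to $I$, put $\mathcal X=\bigcup_k q_kH$, and let $\mathcal L(\mathcal X)$ be the space of all linear maps $\mathcal X\to\mathcal X$. Let $\Phi:\mathcal A\to\mathcal L(\mathcal X)$ be a linear map that is completely positive, i.e. $\sum_{k,l=1}^n(\Phi(a_k^*a_l)\xi_l,\xi_k)\ge 0$ for all $n\in\mathbb N$, $a_1,\dots,a_n\in\mathcal A$, $\xi_1,\dots,\xi_n\in\mathcal X$, and that satisfies $\Phi(p_kap_m)=q_k\Phi(a)q_m$ for all $k,m\in\mathbb N$ and $a\in\mathcal A$.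 Then the following are equivalent: (i) for each $k\in\mathbb N$ the restriction $\Phi|_{p_k\mathcal Ap_k}$ is bounded, i.e. there is a constant $C_k$ with $\|\Phi(a)\xi\|\le C_k\|a\|\|\xi\|$ for all $a\in p_k\mathcal Ap_k$ and $\xi\in\mathcal X$; (ii) there exist a Hilbert space $K$, a $*$-representation $\pi:\mathcal A\to\mathcal B(K)$ that is bounded (i.e. $\|\pi(a)\|\le C\|a\|$ for some constant $C$ and all $a\in\mathcal A$), and a linear operator $V:\mathcal X\to K$ such that $V|_{q_kH}$ is bounded for every $k\in\mathbb N$ and $$(\Phi(a)\xi,\eta)=(\pi(a)V\xi,V\eta),\qquad a\in\mathcal A,\ \xi,\eta\in\mathcal X.$$ Moreover, if (i) holds, then $K$, $\pi$ and $V$ in (ii) can be chosen so that $V$, as an operator from $H$ to $K$ with domain $\mathcal X$, is closable, and, in case $\mathcal B$ and $H$ are separable, so that in addition $K$ is separable. -/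

import Mathlib

open Filter Topology
open scoped ComplexOrder MultiplierAlgebra InnerProductSpace

universe u v w

namespace UnboundedStinespring

/-- An increasing sequence of (orthogonal) projections in a `*`-ring; for projections,
`e ≤ f` means `e * f = e`. -/
structure IsIncreasingProjections {R : Type*} [Mul R] [Star R] (e : ℕ → R) : Prop where
  isStarProjection : ∀ n, IsStarProjection (e n)
  mul_eq : ∀ m n, m ≤ n → e m * e n = e m

section Multiplier

variable {B : Type u} [NonUnitalCStarAlgebra B]

/-- The product `p b` of a multiplier `p` of `B` and an element `b` of `B`, as an element of `B`. -/
noncomputable def leftMul (p : 𝓜(ℂ, B)) (b : B) : B := p.fst b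

/-- The product `b p` of an element `b` of `B` and a multiplier `p` of `B`, as an element of `B`. -/
noncomputable def rightMul (b : B) (p : 𝓜(ℂ, B)) : B := p.snd b

/-- Inside the multiplier algebra, `leftMul p b` is the product of `p` and `b`. -/
theorem coe_leftMul (p : 𝓜(ℂ, B)) (b : B) :
    ((leftMul p b : B) : 𝓜(ℂ, B)) = p * (b : 𝓜(ℂ, B)) := by
  ext x
  · have h := p.central b
    -- Both centralizers have the same left part: `(p b) x = p (b x)`.
    have key : ∀ y : B, y * (p.fst b * x) = y * p.fst (b * x) := by
      intro y
      rw [← mul_assoc, ← p.central, mul_assoc, p.central]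
    have h0 : p.fst b * x - p.fst (b * x) = 0 := by
      rw [← CStarRing.star_mul_self_eq_zero_iff, mul_sub, key, sub_self]
    simpa [leftMul, sub_eq_zero] using h0
  · simp [leftMul, p.central]

/-- Inside the multiplier algebra, `rightMul b p` is the product of `b` and `p`. -/
theorem coe_rightMul (p : 𝓜(ℂ, B)) (b : B) :
    ((rightMul b p : B) : 𝓜(ℂ, B)) = (b : 𝓜(ℂ, B)) * p := by
  ext x
  · simp [rightMul, p.central]
  · have key : ∀ y : B, (x * p.snd b) * y = p.snd (x * b) * y := by
      intro y
      rw [mul_assoc, p.central, ← mul_assoc, ← p.central]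
    have h0 : x * p.snd b - p.snd (x * b) = 0 := by
      rw [← CStarRing.mul_star_self_eq_zero_iff, sub_mul, key, sub_self]
    simpa [rightMul, sub_eq_zero] using h0

end Multiplier

section CompletelyPositive

variable {B : Type u} [NonUnitalCStarAlgebra B] {A : NonUnitalStarSubalgebra ℂ B}
  {H : Type v} [NormedAddCommGroup H] [InnerProductSpace ℂ H] {X : Submodule ℂ H}

/-- Complete positivity of a linear map from a `*`-algebra into the linear maps on a (not
necessarily closed) subspace `X` of `H`. The inner product `⟪x, y⟫_ℂ` is linear in `y`. -/
def IsCompletelyPositive (Φ : A →ₗ[ℂ] (X →ₗ[ℂ] X)) : Prop :=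
  ∀ (n : ℕ) (a : Fin n → A) (ξ : Fin n → X),
    0 ≤ ∑ k, ∑ l, ⟪ξ k, Φ (star (a k) * a l) (ξ l)⟫_ℂ

/-- The restriction of `Φ` to the corner `p A p` is bounded: it takes values in the bounded
operators on `X`, and it is bounded from the norm of `B` to the operator norm. -/
def IsBoundedOnCorner (Φ : A →ₗ[ℂ] (X →ₗ[ℂ] X)) (p : 𝓜(ℂ, B)) : Prop :=
  ∃ C : ℝ, ∀ a b : A, (b : B) = rightMul (leftMul p (a : B)) p →
    ∀ ξ : X, ‖Φ b ξ‖ ≤ C * ‖(b : B)‖ * ‖ξ‖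

/-- `π` is a bounded `*`-representation of `A` on `K`, the operator `V` from `X` to `K` is bounded
on the range of each `q k`, and `(Φ(a)ξ, η) = (π(a)Vξ, Vη)`. -/
structure IsStinespringRep {K : Type w} [NormedAddCommGroup K] [InnerProductSpace ℂ K]
    [CompleteSpace K] (q : ℕ → (H →L[ℂ] H)) (Φ : A →ₗ[ℂ] (X →ₗ[ℂ] X))
    (π : A →⋆ₙₐ[ℂ] (K →L[ℂ] K)) (V : X →ₗ[ℂ] K) : Prop where
  bounded_rep : ∃ C : ℝ, ∀ a : A, ‖π a‖ ≤ C * ‖(a : B)‖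
  bounded_on_range : ∀ k, ∃ C : ℝ, ∀ ξ : X, (ξ : H) ∈ Set.range (q k) → ‖V ξ‖ ≤ C * ‖ξ‖
  inner_eq : ∀ (a : A) (ξ η : X), ⟪η, Φ a ξ⟫_ℂ = ⟪V η, π a (V ξ)⟫_ℂ

end CompletelyPositive

end UnboundedStinespring

/-! For (i) ⇒ (ii), complete positivity makes `⟪ξ, Φ(a* b) η⟫` a positive semidefinite kernel on `A
× X`. It is the Gram matrix of a family `j (a, ξ)` with dense span in a Hilbert space `K`, and `π(a)
j(b, ξ) = j(ab, ξ)`.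

Two estimates are needed. `norm_orbit_le` shows that `π(a)` is contractive: any bound on the
coefficient functions improves itself to the sharp one, and boundedness on corners supplies some
bound. Since `A` need not have a unit, `Vξ` cannot be taken as `j (1, ξ)`. It is the Riesz vector of
the functional `j (b, η) ↦ ⟪ξ, Φ(b) η⟫`, which is bounded by `exists_functional_bound`: replacing
`b` by `e b`, with `e` an approximate unit cut down to a corner, turns the functional into the inner
product with `j (e*, ξ)`, whose norm is controlled on that corner.

Then `π(a) V ξ = j (a, ξ)`, which gives the dilation formula. Closability holds because the adjoint
of `V` is defined on every `j (b, η)`, with value `Φ(b) η`. For (ii) ⇒ (i), `Φ(b) ξ` is paired with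
itself. -/

namespace UnboundedStinespring

/-! ### Hilbert spaces generated by a positive semidefinite kernel -/

section Hilbert

open Finsupp

/-- A Hilbert space together with a family whose Gram matrix is a given positive semidefinite
kernel and whose span is dense. -/
theorem exists_family_of_posSemidef {S : Type u} (κ : S → S → ℂ)
    (hκ : ∀ (n : ℕ) (s : Fin n → S) (c : Fin n → ℂ),
      0 ≤ ∑ i, ∑ j, star (c i) * c j * κ (s i) (s j)) :
    ∃ (K : Type u) (_ : NormedAddCommGroup K) (_ : InnerProductSpace ℂ K) (_ : CompleteSpace K)
      (j : S → K), (∀ s t, ⟪j s, j t⟫_ℂ = κ s t) ∧ DenseRange (linearCombination ℂ j) := by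
  have hherm : ∀ s t, star (κ s t) = κ t s := by
    intro s t
    -- Positive values are real. The coefficient vectors `(1, 1)` and `(1, i)`, together with the
    -- real diagonal, determine the imaginary and real parts of `κ t s`.
    have h1 := (Complex.le_def.1 (hκ 2 ![s, t] ![1, 1])).2
    have h2 := (Complex.le_def.1 (hκ 2 ![s, t] ![1, Complex.I])).2
    have h3 := (Complex.le_def.1 (hκ 1 ![s] ![1])).2
    have h4 := (Complex.le_def.1 (hκ 1 ![t] ![1])).2
    simp [Fin.sum_univ_two] at h1 h2 h3 h4
    apply Complex.ext <;> simp <;> linarith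
  -- Reproducing kernels are operator valued, so the scalar kernel acts by multiples of the identity
  -- of `ℂ`.
  let k : Matrix S S (ℂ →L[ℂ] ℂ) := fun s t => κ s t • ContinuousLinearMap.id ℂ ℂ
  have hk : k.PosSemidef := by
    have hiff : k.PosSemidef ↔ k.IsHermitian ∧ ∀ f : S →₀ ℂ,
        0 ≤ RCLike.re (f.sum fun x w => f.sum fun x' w' => ⟪k x' x w, w'⟫_ℂ) :=
      RKHS.posSemidef_tfae.out 0 2
    refine hiff.2 ⟨?_, fun f => ?_⟩
    · refine Matrix.IsHermitian.ext fun s t => ?_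
      simp only [k, star_smul, hherm]
      rw [← ContinuousLinearMap.one_def, star_one]
    · let e := f.support.equivFin
      have h := (Complex.le_def.1 (hκ _ (fun i => (e.symm i).1) (fun i => f (e.symm i).1))).1
      refine h.trans_eq ?_
      have h2 : ∀ i, (∑ l, star (f (e.symm i).1) * f (e.symm l).1 * κ (e.symm i).1 (e.symm l).1) =
          ∑ y ∈ f.support, star (f (e.symm i).1) * f y * κ (e.symm i).1 y := fun i => by
        rw [← Finset.sum_coe_sort f.support]
        exact e.symm.sum_comp fun y => star (f (e.symm i).1) * f y.1 * κ (e.symm i).1 y.1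
      simp only [h2]
      rw [e.symm.sum_comp fun x : f.support =>
        ∑ y ∈ f.support, star (f x.1) * f y * κ x.1 y,
        Finset.sum_coe_sort f.support fun x => ∑ y ∈ f.support, star (f x) * f y * κ x y]
      simp only [Finsupp.sum, k]
      refine congrArg Complex.re (Finset.sum_congr rfl fun x _ => Finset.sum_congr rfl fun y _ => ?_)
      simp [← hherm y x]
      ring
  have : Fact k.PosSemidef := ⟨hk⟩
  refine ⟨RKHS.OfKernel k, inferInstance, inferInstance, inferInstance,
    fun s => RKHS.kerFun _ s 1, fun s t => ?_, ?_⟩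
  · rw [← RKHS.kernel_inner, RKHS.OfKernel.kernel_ofKernel]
    simp [k]
    exact hherm t s
  · have h := RKHS.kerFun_dense (RKHS.OfKernel k)
    rw [← Submodule.dense_iff_topologicalClosure_eq_top] at h
    refine h.mono ?_
    rw [← LinearMap.coe_range, Finsupp.range_linearCombination, SetLike.coe_subset_coe,
      Submodule.span_le]
    rintro _ ⟨s, z, rfl⟩
    have : RKHS.kerFun (RKHS.OfKernel k) s z = z • RKHS.kerFun (RKHS.OfKernel k) s 1 := by
      rw [← map_smul, smul_eq_mul, mul_one]
    rw [this]
    exact Submodule.smul_mem _ _ (Submodule.subset_span ⟨s, rfl⟩)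

variable {S : Type*} {K : Type*} [NormedAddCommGroup K] [InnerProductSpace ℂ K] {j : S → K}

theorem eq_of_inner_family_eq (hj : DenseRange (linearCombination ℂ j)) {x y : K}
    (h : ∀ s, ⟪x, j s⟫_ℂ = ⟪y, j s⟫_ℂ) : x = y := by
  refine hj.eq_of_inner_left ℂ fun f => ?_
  simp only [linearCombination_apply, Finsupp.sum, inner_sum, inner_smul_right, h]

theorem eq_of_apply_family_eq {F : Type*} [NormedAddCommGroup F] [NormedSpace ℂ F]
    (hj : DenseRange (linearCombination ℂ j)) {T U : K →L[ℂ] F}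
    (h : ∀ s, T (j s) = U (j s)) : T = U := by
  refine DFunLike.coe_injective (hj.equalizer T.continuous U.continuous (funext fun f => ?_))
  simp only [Function.comp_apply, linearCombination_apply, Finsupp.sum, map_sum, map_smul, h]

theorem exists_extension_of_norm_le {F : Type*} [NormedAddCommGroup F] [NormedSpace ℂ F]
    [CompleteSpace F] (hj : DenseRange (linearCombination ℂ j)) (g : S → F) {M : ℝ} (hM : 0 ≤ M)
    (h : ∀ f, ‖linearCombination ℂ g f‖ ≤ M * ‖linearCombination ℂ j f‖) :
    ∃ T : K →L[ℂ] F, ‖T‖ ≤ M ∧ ∀ s, T (j s) = g s := by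
  refine ⟨(linearCombination ℂ g).extendOfNorm (linearCombination ℂ j),
    LinearMap.opNorm_extendOfNorm_le hj hM h, fun s => ?_⟩
  have := LinearMap.extendOfNorm_eq hj ⟨M, h⟩ (single s 1)
  simpa using this

theorem exists_inner_family_eq [CompleteSpace K] (hj : DenseRange (linearCombination ℂ j))
    (g : S → ℂ) {M : ℝ} (hM : 0 ≤ M)
    (h : ∀ f, ‖linearCombination ℂ g f‖ ≤ M * ‖linearCombination ℂ j f‖) :
    ∃ x : K, ‖x‖ ≤ M ∧ ∀ s, ⟪x, j s⟫_ℂ = g s := by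
  obtain ⟨T, hT, hTg⟩ := exists_extension_of_norm_le hj g hM h
  refine ⟨(InnerProductSpace.toDual ℂ K).symm T, by simpa using hT, fun s => ?_⟩
  rw [InnerProductSpace.toDual_symm_apply, hTg]

end Hilbert

/-- An orbit `a ↦ F a` of a `*`-representation through the vector `x` is bounded by `‖x‖`
as soon as its coefficient function at `x` is bounded by any constant. -/
theorem norm_orbit_le {B : Type*} [NonUnitalCStarAlgebra B] {A : NonUnitalStarSubalgebra ℂ B}
    {K : Type*} [NormedAddCommGroup K] [InnerProductSpace ℂ K] (F : A → K) (x : K)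
    (hF : ∀ a, ⟪F a, F a⟫_ℂ = ⟪x, F (star a * a)⟫_ℂ)
    (hD : ∃ D : ℝ, ∀ a, ‖⟪x, F a⟫_ℂ‖ ≤ D * ‖(a : B)‖) (a : A) :
    ‖F a‖ ≤ ‖x‖ * ‖(a : B)‖ := by
  have hstar : ∀ a : A, ‖((star a * a : A) : B)‖ = ‖(a : B)‖ ^ 2 := fun a => by
    simp [CStarRing.norm_star_mul_self, sq]
  have hsq : ∀ a, ‖F a‖ ^ 2 = ‖⟪x, F (star a * a)⟫_ℂ‖ := fun a => by
    rw [← hF, inner_self_eq_norm_sq_to_K]; simp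
  -- The set of admissible constants is closed, so its infimum `M` is admissible. The crude bound
  -- `D` only serves to make the set nonempty.
  let s : Set ℝ := {M | 0 ≤ M ∧ ∀ a, ‖F a‖ ≤ M * ‖(a : B)‖}
  have hbdd : BddBelow s := ⟨0, fun M hM => hM.1⟩
  have hne : s.Nonempty := by
    obtain ⟨D, hD⟩ := hD
    refine ⟨√|D|, Real.sqrt_nonneg _, fun a => abs_le_of_sq_le_sq' ?_ (by positivity) |>.2⟩
    rw [hsq, mul_pow, Real.sq_sqrt (abs_nonneg _), ← hstar]
    exact (hD _).trans (by gcongr; exact le_abs_self D)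
  have hmem : sInf s ∈ s := by
    have hclosed : IsClosed s := by
      simp only [s, Set.ofPred_and, Set.ofPred_forall]
      exact (isClosed_le continuous_const continuous_id).inter
        (isClosed_iInter fun a => isClosed_le continuous_const (by fun_prop))
    exact hclosed.csInf_mem hne hbdd
  set M := sInf s
  have hM0 : 0 ≤ M := hmem.1
  -- Cauchy–Schwarz and the bound `M` at `a* a` make `√(‖x‖ M)` admissible too. Hence `M² ≤ ‖x‖ M`,
  -- that is, `M ≤ ‖x‖`.
  have hle : M ≤ √(‖x‖ * M) := by
    refine csInf_le hbdd ⟨Real.sqrt_nonneg _, fun a => abs_le_of_sq_le_sq' ?_ (by positivity) |>.2⟩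
    rw [hsq, mul_pow, Real.sq_sqrt (by positivity), ← hstar, mul_assoc]
    exact (norm_inner_le_norm _ _).trans (by gcongr; exact hmem.2 _)
  have hMx : M ≤ ‖x‖ := by
    by_contra! hlt
    have h1 := (Real.le_sqrt hM0 (by positivity)).1 hle
    nlinarith [norm_nonneg x]
  exact (hmem.2 a).trans (by gcongr)

/-! ### Multiplier calculus, corners and approximate units -/

section Corner

variable {B : Type u} [NonUnitalCStarAlgebra B]

theorem leftMul_leftMul (p r : 𝓜(ℂ, B)) (b : B) :
    leftMul p (leftMul r b) = leftMul (p * r) b := rfl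

theorem rightMul_rightMul (p r : 𝓜(ℂ, B)) (b : B) :
    rightMul (rightMul b p) r = rightMul b (p * r) := rfl

theorem rightMul_mul (p : 𝓜(ℂ, B)) (b c : B) : rightMul b p * c = b * leftMul p c :=
  p.central b c

theorem leftMul_mul (p : 𝓜(ℂ, B)) (b c : B) : leftMul p (b * c) = leftMul p b * c := by
  have h := congrArg (fun x : 𝓜(ℂ, B) => x.fst c) (coe_leftMul p b)
  simpa [leftMul] using h.symm

theorem mul_rightMul (p : 𝓜(ℂ, B)) (b c : B) : rightMul (b * c) p = b * rightMul c p := by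
  have h := congrArg (fun x : 𝓜(ℂ, B) => x.snd b) (coe_rightMul p c)
  simpa [rightMul] using h.symm

theorem star_leftMul (p : 𝓜(ℂ, B)) (b : B) : star (leftMul p b) = rightMul (star b) (star p) := by
  simp [leftMul, rightMul]

theorem star_rightMul (p : 𝓜(ℂ, B)) (b : B) : star (rightMul b p) = leftMul (star p) (star b) := by
  simp [leftMul, rightMul]

/-- Both sides have the same product with every `c`. Taking `c` to be the adjoint of their
difference, the C*-identity makes that difference vanish. -/
theorem rightMul_leftMul (p r : 𝓜(ℂ, B)) (b : B) :
    rightMul (leftMul p b) r = leftMul p (rightMul b r) := by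
  rw [← sub_eq_zero, ← CStarRing.mul_star_self_eq_zero_iff, sub_mul]
  have h : ∀ c, rightMul (leftMul p b) r * c = leftMul p (rightMul b r) * c := fun c => by
    rw [rightMul_mul, ← leftMul_mul, ← leftMul_mul, rightMul_mul]
  rw [h, sub_self]

theorem norm_leftMul_le (p : 𝓜(ℂ, B)) (b : B) : ‖leftMul p b‖ ≤ ‖p‖ * ‖b‖ := by
  rw [← DoubleCentralizer.norm_fst]; exact p.fst.le_opNorm b

theorem norm_rightMul_le (p : 𝓜(ℂ, B)) (b : B) : ‖rightMul b p‖ ≤ ‖p‖ * ‖b‖ := by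
  rw [← DoubleCentralizer.norm_snd]; exact p.snd.le_opNorm b

theorem leftMul_sub (p : 𝓜(ℂ, B)) (b c : B) : leftMul p (b - c) = leftMul p b - leftMul p c :=
  map_sub p.fst b c

theorem rightMul_sub (p : 𝓜(ℂ, B)) (b c : B) : rightMul (b - c) p = rightMul b p - rightMul c p :=
  map_sub p.snd b c

/-- `b` lies in the corner `p B p`. -/
def InCorner (p : 𝓜(ℂ, B)) (b : B) : Prop := leftMul p b = b ∧ rightMul b p = b

theorem InCorner.star {p : 𝓜(ℂ, B)} (hp : IsSelfAdjoint p) {b : B} (h : InCorner p b) :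
    InCorner p (star b) := by
  constructor
  · conv_rhs => rw [← h.2, star_rightMul, hp.star_eq]
  · conv_rhs => rw [← h.1, star_leftMul, hp.star_eq]

theorem InCorner.mul {p : 𝓜(ℂ, B)} {b c : B} (hb : leftMul p b = b) (hc : rightMul c p = c) :
    InCorner p (b * c) :=
  ⟨by rw [leftMul_mul, hb], by rw [mul_rightMul, hc]⟩

theorem IsIncreasingProjections.mul_eq' {R : Type*} [Mul R] [StarMul R] {e : ℕ → R}
    (he : IsIncreasingProjections e) {m n : ℕ} (h : m ≤ n) : e n * e m = e m := by
  have := congrArg star (he.mul_eq m n h)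
  rwa [star_mul, (he.isStarProjection m).isSelfAdjoint.star_eq,
    (he.isStarProjection n).isSelfAdjoint.star_eq] at this

theorem inCorner_of_le {p : ℕ → 𝓜(ℂ, B)} (hp : IsIncreasingProjections p) {k m : ℕ} (hkm : k ≤ m)
    (b : B) : InCorner (p m) (rightMul (leftMul (p k) b) (p k)) := by
  constructor
  · rw [← rightMul_leftMul, leftMul_leftMul, hp.mul_eq' hkm]
  · rw [rightMul_rightMul, hp.mul_eq _ _ hkm]

/-- A dense `*`-subalgebra of a C*-algebra contains a bounded approximate unit. -/
theorem exists_approximateUnit_of_dense (A : NonUnitalStarSubalgebra ℂ B)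
    (hA : Dense (A : Set B)) :
    ∃ l : Filter A, l.NeBot ∧ (∀ᶠ a : A in l, ‖(a : B)‖ ≤ 2) ∧
      ∀ b : B, Tendsto (fun a : A => (a : B) * b) l (𝓝 b) := by
  let _ := CStarAlgebra.spectralOrder B
  have := CStarAlgebra.spectralOrderedRing B
  have hl := CStarAlgebra.increasingApproximateUnit B
  have := hl.neBot
  have hfst : Tendsto Prod.fst (CStarAlgebra.approximateUnit B ×ˢ (atTop : Filter ℕ))
    (CStarAlgebra.approximateUnit B) := tendsto_fst
  -- Each element is approximated from `A` within `1 / (n + 1)`. Along the product filter the error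
  -- tends to zero, and being at most `1` it raises the norm bound from `1` to `2`.
  have hex : ∀ x : B × ℕ, ∃ a : A, dist x.1 (a : B) < 1 / ((x.2 : ℝ) + 1) := fun x => by
    obtain ⟨a, ha, h⟩ := Metric.dense_iff.1 hA x.1 _ (Nat.one_div_pos_of_nat (n := x.2) (α := ℝ))
    exact ⟨⟨a, h⟩, by simpa [dist_comm] using ha⟩
  choose f hf using hex
  have hlim : Tendsto (fun x : B × ℕ => x.1 - (f x : B))
      (CStarAlgebra.approximateUnit B ×ˢ atTop) (𝓝 0) :=
    squeeze_zero_norm (fun x => by rw [← dist_eq_norm]; exact (hf x).le)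
      (tendsto_one_div_add_atTop_nhds_zero_nat.comp tendsto_snd)
  refine ⟨(CStarAlgebra.approximateUnit B ×ˢ atTop).map f, inferInstance, ?_, fun b => ?_⟩
  · have h1 := hfst.eventually hl.eventually_norm
    rw [eventually_map]
    filter_upwards [h1] with x hx
    have h2 : ‖x.1 - (f x : B)‖ ≤ 1 := by
      rw [← dist_eq_norm]
      refine (hf x).le.trans ?_
      rw [div_le_one (by positivity)]
      linarith [(Nat.cast_nonneg x.2 : (0 : ℝ) ≤ x.2)]
    calc ‖(f x : B)‖ = ‖x.1 - (x.1 - (f x : B))‖ := by rw [sub_sub_cancel]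
      _ ≤ ‖x.1‖ + ‖x.1 - (f x : B)‖ := norm_sub_le _ _
      _ ≤ 2 := by linarith
  · rw [tendsto_map'_iff]
    have h1 := ((hl.tendsto_mul_right b).comp hfst).sub
      (hlim.mul_const b)
    simpa [Function.comp_def, sub_mul] using h1

end Corner

/-! ### Estimates in the dilation space -/

section Dilation

open Finsupp

variable {B : Type u} [NonUnitalCStarAlgebra B] {A : NonUnitalStarSubalgebra ℂ B}
  {H : Type v} [NormedAddCommGroup H] [InnerProductSpace ℂ H] {X : Submodule ℂ H}
  {p : ℕ → 𝓜(ℂ, B)} {q : ℕ → (H →L[ℂ] H)} {Φ : A →ₗ[ℂ] (X →ₗ[ℂ] X)}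

/-- `Φ` is compatible on the left with the filtrations of `A` and `X` given by `p` and `q`, and it
is bounded on each corner `p k A p k`. -/
structure IsCornerBounded [CompleteSpace H] (p : ℕ → 𝓜(ℂ, B)) (q : ℕ → (H →L[ℂ] H))
    (Φ : A →ₗ[ℂ] (X →ₗ[ℂ] X)) : Prop where
  isIncreasing : IsIncreasingProjections p
  isStarProjection : ∀ k, IsStarProjection (q k)
  leftMul_mem : ∀ k, ∀ a ∈ A, leftMul (p k) a ∈ A
  rightMul_mem : ∀ k, ∀ a ∈ A, rightMul a (p k) ∈ A
  exists_inCorner : ∀ a : A, ∃ k, ∀ m, k ≤ m → InCorner (p m) (a : B)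
  exists_fixed : ∀ ξ : X, ∃ k, q k ξ = ξ
  apply_leftMul : ∀ k (a a' : A), (a' : B) = leftMul (p k) (a : B) →
    ∀ ξ, (Φ a' ξ : H) = q k (Φ a ξ)
  exists_bound : ∀ k, ∃ C : ℝ, 0 ≤ C ∧ ∀ b : A, InCorner (p k) (b : B) →
    ∀ ξ, ‖Φ b ξ‖ ≤ C * ‖(b : B)‖ * ‖ξ‖

/-- The product `b* a c` stays in one corner, fixed by `b` and `c`, whatever `a` is. This is the
crude bound that `norm_orbit_le` asks for. -/
theorem IsCornerBounded.exists_coefficient_bound [CompleteSpace H] (h : IsCornerBounded p q Φ)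
    (b c : A) (ξ η : X) :
    ∃ D : ℝ, ∀ a : A, ‖⟪ξ, Φ (star b * (a * c)) η⟫_ℂ‖ ≤ D * ‖(a : B)‖ := by
  obtain ⟨k, hk⟩ := h.exists_inCorner b
  obtain ⟨l, hl⟩ := h.exists_inCorner c
  have hb := (hk (max k l) (le_max_left _ _)).star
    (h.isIncreasing.isStarProjection _).isSelfAdjoint
  have hc := hl (max k l) (le_max_right _ _)
  obtain ⟨C, hC0, hC⟩ := h.exists_bound (max k l)
  refine ⟨‖ξ‖ * (C * (‖(b : B)‖ * ‖(c : B)‖) * ‖η‖), fun a => ?_⟩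
  have hcorner : InCorner (p (max k l)) ((star b * (a * c) : A) : B) := by
    refine InCorner.mul hb.1 ?_
    change rightMul ((a : B) * (c : B)) _ = (a : B) * (c : B)
    rw [mul_rightMul, hc.2]
  have hnorm : ‖((star b * (a * c) : A) : B)‖ ≤ ‖(b : B)‖ * (‖(a : B)‖ * ‖(c : B)‖) := by
    refine (norm_mul_le _ _).trans ?_
    rw [show ‖((star b : A) : B)‖ = ‖(b : B)‖ from norm_star _]
    gcongr
    exact norm_mul_le _ _
  calc ‖⟪ξ, Φ (star b * (a * c)) η⟫_ℂ‖ ≤ ‖ξ‖ * ‖Φ (star b * (a * c)) η‖ := norm_inner_le_norm _ _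
    _ ≤ ‖ξ‖ * (C * (‖(b : B)‖ * (‖(a : B)‖ * ‖(c : B)‖)) * ‖η‖) := by
        gcongr
        exact (hC _ hcorner η).trans (by gcongr)
    _ = _ := by ring

/-- The positive semidefinite kernel of a completely positive map. -/
noncomputable def stinespringKernel (Φ : A →ₗ[ℂ] (X →ₗ[ℂ] X)) (s t : A × X) : ℂ :=
  ⟪s.2, Φ (star s.1 * t.1) t.2⟫_ℂ

theorem IsCompletelyPositive.kernel_nonneg (hΦ : IsCompletelyPositive Φ) (n : ℕ)
    (s : Fin n → A × X) (c : Fin n → ℂ) :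
    0 ≤ ∑ i, ∑ j, star (c i) * c j * stinespringKernel Φ (s i) (s j) := by
  convert hΦ n (fun i => (s i).1) (fun i => c i • (s i).2) using 4 with i _ j
  simp only [stinespringKernel, map_smul, inner_smul_left, inner_smul_right]
  simp only [starRingEnd_apply]
  ring

variable {K : Type w} [NormedAddCommGroup K] [InnerProductSpace ℂ K] {j : A × X → K}

theorem inner_linearCombination (hj : ∀ s t, ⟪j s, j t⟫_ℂ = stinespringKernel Φ s t) (s : A × X)
    (σ : A × X → A × X) (f : A × X →₀ ℂ) :
    ⟪j s, linearCombination ℂ (fun t => j (σ t)) f⟫_ℂ =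
      f.sum fun t c => c * stinespringKernel Φ s (σ t) := by
  simp only [linearCombination_apply, Finsupp.sum, inner_sum, inner_smul_right, hj]

theorem IsCornerBounded.norm_translate_le [CompleteSpace H] (h : IsCornerBounded p q Φ)
    (hj : ∀ s t, ⟪j s, j t⟫_ℂ = stinespringKernel Φ s t) (a : A) (f : A × X →₀ ℂ) :
    ‖linearCombination ℂ (fun s => j (a * s.1, s.2)) f‖ ≤
      ‖(a : B)‖ * ‖linearCombination ℂ j f‖ := by
  have key : ∀ (σ τ : A × X → A × X),
      ⟪linearCombination ℂ (fun s => j (σ s)) f, linearCombination ℂ (fun s => j (τ s)) f⟫_ℂ =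
        ∑ s ∈ f.support, ∑ t ∈ f.support,
          star (f s) * (f t * stinespringKernel Φ (σ s) (τ t)) := fun σ τ => by
    rw [linearCombination_apply, Finsupp.sum, sum_inner]
    refine Finset.sum_congr rfl fun s _ => ?_
    rw [inner_smul_left, inner_linearCombination hj, Finsupp.sum, Finset.mul_sum]
    rfl
  rw [mul_comm]
  refine norm_orbit_le (fun a : A => linearCombination ℂ (fun s : A × X => j (a * s.1, s.2)) f)
    (linearCombination ℂ j f) (fun a => ?_) ?_ a
  · refine (key _ _).trans (Eq.trans ?_ (key id _).symm)
    simp [stinespringKernel, mul_assoc]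
  · choose D hD using h.exists_coefficient_bound
    refine ⟨∑ s ∈ f.support, ∑ t ∈ f.support, ‖f s‖ * (‖f t‖ * D s.1 t.1 s.2 t.2), fun a => ?_⟩
    refine (congrArg norm (key id fun s => (a * s.1, s.2))).le.trans ?_
    simp only [Finset.sum_mul]
    refine norm_sum_le_of_le _ fun s _ => norm_sum_le_of_le _ fun t _ => ?_
    rw [norm_mul, norm_star, norm_mul, mul_assoc, mul_assoc]
    gcongr
    exact hD _ _ _ _ a

/-- Since `ξ` is fixed by `q k`, `b` may be replaced by `p k b`. The difference `e b - p k b = p k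
(a p k b - p k b)` lies in a single corner for all `a` and tends to zero in norm, so boundedness on
that corner applies. -/
theorem IsCornerBounded.tendsto_approximateUnit [CompleteSpace H] (h : IsCornerBounded p q Φ)
    {l : Filter A} (hl : ∀ b : B, Tendsto (fun a : A => (a : B) * b) l (𝓝 b)) {k : ℕ}
    {e : A → A} (he : ∀ a, (e a : B) = rightMul (leftMul (p k) (a : B)) (p k))
    {ξ : X} (hξ : q k ξ = ξ) (b : A) (η : X) :
    Tendsto (fun a => ⟪ξ, Φ (e a * b) η⟫_ℂ) l (𝓝 ⟪ξ, Φ b η⟫_ℂ) := by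
  obtain ⟨m₀, hm₀⟩ := h.exists_inCorner b
  set m := max k m₀
  have hm := hm₀ m (le_max_right _ _)
  obtain ⟨C, hC0, hC⟩ := h.exists_bound m
  set pb : A := ⟨leftMul (p k) (b : B), h.leftMul_mem k _ b.2⟩ with hpb
  have hpp : leftMul (p k) (pb : B) = pb := by
    change leftMul (p k) (leftMul (p k) (b : B)) = leftMul (p k) (b : B)
    rw [leftMul_leftMul, (h.isIncreasing.isStarProjection k).isIdempotentElem.eq]
  have hpr : rightMul (pb : B) (p m) = pb := by
    change rightMul (leftMul (p k) (b : B)) (p m) = leftMul (p k) (b : B)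
    rw [rightMul_leftMul, hm.2]
  have hξb : ⟪ξ, Φ b η⟫_ℂ = ⟪ξ, Φ pb η⟫_ℂ := by
    rw [Submodule.coe_inner, Submodule.coe_inner, h.apply_leftMul k b pb rfl]
    conv_lhs => rw [← hξ]
    rw [← ContinuousLinearMap.adjoint_inner_right, (h.isStarProjection k).isSelfAdjoint.adjoint_eq]
  have hdiff : ∀ a : A, ((e a * b - pb : A) : B) = leftMul (p k) ((a : B) * (pb : B) - pb) := by
    intro a
    change (e a : B) * (b : B) - (pb : B) = _
    rw [he, rightMul_mul, leftMul_sub, hpp, leftMul_mul]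
  have hcorner : ∀ a : A, InCorner (p m) ((e a * b - pb : A) : B) := fun a => by
    rw [hdiff]
    constructor
    · rw [leftMul_leftMul, h.isIncreasing.mul_eq' (le_max_left _ _)]
    · rw [rightMul_leftMul, rightMul_sub, mul_rightMul, hpr]
  have hzero : Tendsto (fun a : A => ‖ξ‖ * (C * (‖p k‖ * ‖(a : B) * (pb : B) - pb‖) * ‖η‖)) l
      (𝓝 0) := by
    have := (((tendsto_sub_nhds_zero_iff.2 (hl (pb : B))).norm.const_mul ‖p k‖).const_mul
      C).mul_const ‖η‖ |>.const_mul ‖ξ‖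
    simpa using this
  rw [hξb]
  refine tendsto_sub_nhds_zero_iff.1 (squeeze_zero_norm (fun a => ?_) hzero)
  rw [← inner_sub_right, ← LinearMap.sub_apply, ← map_sub]
  refine (norm_inner_le_norm _ _).trans ?_
  gcongr
  refine (hC _ (hcorner a) η).trans ?_
  rw [hdiff]
  gcongr
  exact norm_leftMul_le _ _

/-- A Kadison–Schwarz type estimate: the functional `b ⊗ η ↦ ⟪ξ, Φ b η⟫` is bounded for the
norm of the dilation space, uniformly for `ξ` in the unit ball of the range of `q k`. -/
theorem IsCornerBounded.exists_functional_bound [CompleteSpace H] (h : IsCornerBounded p q Φ)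
    (hA : Dense (A : Set B)) (hj : ∀ s t, ⟪j s, j t⟫_ℂ = stinespringKernel Φ s t) (k : ℕ) :
    ∃ M : ℝ, 0 ≤ M ∧ ∀ ξ : X, q k ξ = ξ → ∀ f : A × X →₀ ℂ,
      ‖linearCombination ℂ (fun s : A × X => ⟪ξ, Φ s.1 s.2⟫_ℂ) f‖ ≤
        M * ‖ξ‖ * ‖linearCombination ℂ j f‖ := by
  obtain ⟨l, hne, hl2, hl⟩ := exists_approximateUnit_of_dense A hA
  obtain ⟨C, hC0, hC⟩ := h.exists_bound k
  set e : A → A := fun a => ⟨rightMul (leftMul (p k) (a : B)) (p k),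
    h.rightMul_mem k _ (h.leftMul_mem k _ a.2)⟩
  have hsa := (h.isIncreasing.isStarProjection k).isSelfAdjoint
  have hcorner : ∀ a, InCorner (p k) (e a : B) := fun a => inCorner_of_le h.isIncreasing le_rfl _
  -- `√C` comes from `‖j (e*, ξ)‖² = ⟪ξ, Φ(e e*) ξ⟫ ≤ C ‖e‖² ‖ξ‖²`, and the other factor bounds `‖e‖
  -- = ‖p k a p k‖` when `‖a‖ ≤ 2`.
  refine ⟨√C * (‖p k‖ * (‖p k‖ * 2)), by positivity, fun ξ hξ f => ?_⟩
  have hlim : Tendsto (fun a => ⟪j (star (e a), ξ), linearCombination ℂ j f⟫_ℂ) l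
      (𝓝 (linearCombination ℂ (fun s : A × X => ⟪ξ, Φ s.1 s.2⟫_ℂ) f)) := by
    have h1 : ∀ a, ⟪j (star (e a), ξ), linearCombination ℂ j f⟫_ℂ =
        ∑ t ∈ f.support, f t * ⟪ξ, Φ (e a * t.1) t.2⟫_ℂ := fun a => by
      refine (inner_linearCombination hj _ id f).trans ?_
      simp [stinespringKernel, Finsupp.sum]
    refine Tendsto.congr (fun a => (h1 a).symm) ?_
    rw [linearCombination_apply, Finsupp.sum]
    exact tendsto_finsetSum _ fun t _ =>
      (h.tendsto_approximateUnit hl (e := e) (fun _ => rfl) hξ t.1 t.2).const_mul _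
  refine le_of_tendsto hlim.norm (hl2.mono fun a ha => (norm_inner_le_norm _ _).trans ?_)
  gcongr
  have hea : ‖(e a : B)‖ ≤ ‖p k‖ * (‖p k‖ * 2) := by
    refine (norm_rightMul_le _ _).trans ?_
    gcongr
    exact (norm_leftMul_le _ _).trans (by gcongr)
  have hmul : ‖((e a * star (e a) : A) : B)‖ = ‖(e a : B)‖ ^ 2 := by
    rw [sq]; exact CStarRing.norm_self_mul_star
  refine abs_le_of_sq_le_sq' ?_ (by positivity) |>.2
  have h2 : ‖j (star (e a), ξ)‖ ^ 2 = ‖⟪ξ, Φ (e a * star (e a)) ξ⟫_ℂ‖ := by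
    have h3 := hj (star (e a), ξ) (star (e a), ξ)
    simp only [stinespringKernel, star_star] at h3
    rw [← h3, inner_self_eq_norm_sq_to_K]
    simp
  calc ‖j (star (e a), ξ)‖ ^ 2 = ‖⟪ξ, Φ (e a * star (e a)) ξ⟫_ℂ‖ := h2
    _ ≤ ‖ξ‖ * (C * ‖(e a : B)‖ ^ 2 * ‖ξ‖) := by
        refine (norm_inner_le_norm _ _).trans ?_
        gcongr
        rw [← hmul]
        exact hC _ (InCorner.mul (hcorner a).1 ((hcorner a).star hsa).2) ξ
    _ ≤ ‖ξ‖ * (C * (‖p k‖ * (‖p k‖ * 2)) ^ 2 * ‖ξ‖) := by gcongr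
    _ = (√C * (‖p k‖ * (‖p k‖ * 2)) * ‖ξ‖) ^ 2 := by
        rw [mul_pow _ ‖ξ‖, mul_pow √C, Real.sq_sqrt hC0]; ring

end Dilation

/-! ### The representation, the operator, and the converse -/

section Theorem

open Finsupp

variable {B : Type u} [NonUnitalCStarAlgebra B] {A : NonUnitalStarSubalgebra ℂ B}
  {H : Type v} [NormedAddCommGroup H] [InnerProductSpace ℂ H] {X : Submodule ℂ H}
  {p : ℕ → 𝓜(ℂ, B)} {q : ℕ → (H →L[ℂ] H)} {Φ : A →ₗ[ℂ] (X →ₗ[ℂ] X)}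
  {K : Type w} [NormedAddCommGroup K] [InnerProductSpace ℂ K] {j : A × X → K}

theorem IsCornerBounded.exists_rep [CompleteSpace H] [CompleteSpace K] (h : IsCornerBounded p q Φ)
    (hd : DenseRange (linearCombination ℂ j))
    (hj : ∀ s t, ⟪j s, j t⟫_ℂ = stinespringKernel Φ s t) :
    ∃ π : A →⋆ₙₐ[ℂ] (K →L[ℂ] K), (∀ a : A, ‖π a‖ ≤ ‖(a : B)‖) ∧
      ∀ a s, π a (j s) = j (a * s.1, s.2) := by
  have hex : ∀ a : A, ∃ T : K →L[ℂ] K, ‖T‖ ≤ ‖(a : B)‖ ∧ ∀ s, T (j s) = j (a * s.1, s.2) :=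
    fun a => exists_extension_of_norm_le hd _ (norm_nonneg _) (h.norm_translate_le hj a)
  choose T hT hTj using hex
  refine ⟨{ toFun := T, map_smul' := ?_, map_zero' := ?_, map_add' := ?_, map_mul' := ?_,
            map_star' := ?_ }, hT, hTj⟩
  · intro c a
    -- The family `j` is not known to be linear in its first entry. Linearity is read off from the
    -- kernel by pairing with all `j t`.
    refine eq_of_apply_family_eq hd fun s => eq_of_inner_family_eq hd fun t => ?_
    have hsmul : star ((c • a) * s.1) * t.1 = star c • (star (a * s.1) * t.1) :=
      Subtype.ext (by simp [smul_mul_assoc])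
    simp only [hTj, hj, stinespringKernel, hsmul, _root_.smul_apply, inner_smul_left,
      map_smul, LinearMap.smul_apply, inner_smul_right]
    rfl
  · refine eq_of_apply_family_eq hd fun s => eq_of_inner_family_eq hd fun t => ?_
    simp [hTj, hj, stinespringKernel]
  · intro a b
    refine eq_of_apply_family_eq hd fun s => eq_of_inner_family_eq hd fun t => ?_
    simp [hTj, hj, stinespringKernel, add_mul]
  · intro a b
    refine eq_of_apply_family_eq hd fun s => ?_
    simp [hTj, mul_assoc]
  · intro a
    refine eq_of_apply_family_eq hd fun s => eq_of_inner_family_eq hd fun t => ?_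
    rw [ContinuousLinearMap.star_eq_adjoint, ContinuousLinearMap.adjoint_inner_left]
    simp [hTj, hj, stinespringKernel, mul_assoc]

theorem IsCornerBounded.exists_operator [CompleteSpace H] [CompleteSpace K] (h : IsCornerBounded p q Φ) (hA : Dense (A : Set B))
    (hd : DenseRange (linearCombination ℂ j))
    (hj : ∀ s t, ⟪j s, j t⟫_ℂ = stinespringKernel Φ s t) :
    ∃ V : X →ₗ[ℂ] K, (∀ ξ s, ⟪V ξ, j s⟫_ℂ = ⟪ξ, Φ s.1 s.2⟫_ℂ) ∧
      ∀ k, ∃ C : ℝ, ∀ ξ : X, (ξ : H) ∈ Set.range (q k) → ‖V ξ‖ ≤ C * ‖ξ‖ := by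
  choose M hM0 hM using h.exists_functional_bound hA hj
  have hex : ∀ ξ : X, ∃ x : K, ∀ s, ⟪x, j s⟫_ℂ = ⟪ξ, Φ s.1 s.2⟫_ℂ := fun ξ => by
    obtain ⟨k, hk⟩ := h.exists_fixed ξ
    obtain ⟨x, -, hx⟩ := exists_inner_family_eq hd _
      (mul_nonneg (hM0 k) (norm_nonneg ξ)) (hM k ξ hk)
    exact ⟨x, hx⟩
  choose V hV using hex
  refine ⟨{ toFun := V, map_add' := fun ξ η => ?_, map_smul' := fun c ξ => ?_ }, hV,
    fun k => ⟨M k, ?_⟩⟩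
  · exact eq_of_inner_family_eq hd fun s => by simp [hV]
  · exact eq_of_inner_family_eq hd fun s => by simp [hV]
  · rintro ξ ⟨η, hη⟩
    have hk : q k ξ = ξ := by
      rw [← hη]
      exact congrArg (fun T : H →L[ℂ] H => T η) (h.isStarProjection k).isIdempotentElem.eq
    obtain ⟨x, hxn, hx⟩ := exists_inner_family_eq hd _
      (mul_nonneg (hM0 k) (norm_nonneg ξ)) (hM k ξ hk)
    have : V ξ = x := eq_of_inner_family_eq hd fun s => by rw [hV, hx]
    simpa [this] using hxn

/-- The relation `⟪Vξ, j s⟫ = ⟪ξ, Φ s.1 s.2⟫` is closed in the pair `(ξ, Vξ)`, so it survives on the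
closure of the graph. A point `(0, y)` there has `y` orthogonal to a dense span. -/
theorem isClosable_of_inner_eq (hd : DenseRange (linearCombination ℂ j)) {V : X →ₗ[ℂ] K}
    (hV : ∀ ξ s, ⟪V ξ, j s⟫_ℂ = ⟪ξ, Φ s.1 s.2⟫_ℂ) :
    LinearPMap.IsClosable (⟨X, V⟩ : H →ₗ.[ℂ] K) := by
  refine ⟨_, (Submodule.toLinearPMap_graph_eq _ ?_).symm⟩
  have hgraph : ∀ x ∈ (⟨X, V⟩ : H →ₗ.[ℂ] K).graph.topologicalClosure, ∀ s,
      ⟪x.2, j s⟫_ℂ = ⟪x.1, (Φ s.1 s.2 : H)⟫_ℂ := by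
    intro x hx s
    have hclosed : IsClosed {x : H × K | ⟪x.2, j s⟫_ℂ = ⟪x.1, (Φ s.1 s.2 : H)⟫_ℂ} :=
      isClosed_eq (by fun_prop) (by fun_prop)
    refine closure_minimal ?_ hclosed hx
    rintro y hy
    obtain ⟨ξ, h1, h2⟩ := LinearPMap.mem_graph_iff _ |>.1 hy
    change ⟪y.2, j s⟫_ℂ = ⟪y.1, (Φ s.1 s.2 : H)⟫_ℂ
    rw [← h1, ← h2]
    exact hV ξ s
  intro x hx hx0
  refine eq_of_inner_family_eq hd fun s => ?_
  rw [hgraph x hx s, hx0, inner_zero_left, inner_zero_left]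

/-- Each `V ∘ q k` is bounded on `H`, so the range of `V` is a countable union of separable sets.
Joint continuity of `(a, x) ↦ π(a) x` carries separability to the family `j`, whose span is dense.
-/
theorem separableSpace_of_rep [CompleteSpace K] [TopologicalSpace.SeparableSpace B]
    [TopologicalSpace.SeparableSpace H] (hfix : ∀ ξ : X, ∃ k, q k ξ = ξ)
    (hq : ∀ k ξ, q k ξ ∈ X) (hd : DenseRange (linearCombination ℂ j))
    {π : A →⋆ₙₐ[ℂ] (K →L[ℂ] K)} (hπ : ∀ a : A, ‖π a‖ ≤ ‖(a : B)‖) {V : X →ₗ[ℂ] K}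
    (hVb : ∀ k, ∃ C : ℝ, ∀ ξ : X, (ξ : H) ∈ Set.range (q k) → ‖V ξ‖ ≤ C * ‖ξ‖)
    (hπV : ∀ a ξ, π a (V ξ) = j (a, ξ)) : TopologicalSpace.SeparableSpace K := by
  have hVsep : TopologicalSpace.IsSeparable (Set.range V) := by
    have hsub : Set.range V ⊆ ⋃ k, Set.range fun ξ : H => V ⟨q k ξ, hq k ξ⟩ := by
      rintro _ ⟨ξ, rfl⟩
      obtain ⟨k, hk⟩ := hfix ξ
      exact Set.mem_iUnion.2 ⟨k, ξ, congrArg V (Subtype.ext hk)⟩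
    refine (TopologicalSpace.IsSeparable.iUnion fun k => ?_).mono hsub
    obtain ⟨C, hC⟩ := hVb k
    let L : H →ₗ[ℂ] K := V ∘ₗ (q k).toLinearMap.codRestrict X (hq k)
    have hL : Continuous L := by
      refine (L.mkContinuous (|C| * ‖q k‖) fun ξ => ?_).continuous
      refine (hC _ ⟨ξ, rfl⟩).trans ?_
      rw [mul_assoc]
      gcongr
      · exact le_abs_self C
      · exact (q k).le_opNorm ξ
    exact TopologicalSpace.isSeparable_range hL
  have : TopologicalSpace.SeparableSpace A := inferInstance
  let πL : A →L[ℂ] (K →L[ℂ] K) :=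
    LinearMap.mkContinuous
      { toFun := π, map_add' := map_add π, map_smul' := fun c a => map_smul π c a } 1
      fun a => by simpa using hπ a
  have hcont : Continuous fun x : A × K => π x.1 x.2 :=
    (πL.continuous.comp continuous_fst).clm_apply continuous_snd
  have hjsep : TopologicalSpace.IsSeparable (Set.range j) := by
    refine (((TopologicalSpace.IsSeparable.of_separableSpace (Set.univ : Set A)).prod
      hVsep).image hcont).mono ?_
    rintro _ ⟨⟨a, ξ⟩, rfl⟩
    exact ⟨(a, V ξ), ⟨trivial, ξ, rfl⟩, hπV a ξ⟩
  have hspan := (hjsep.span (R := ℂ)).closure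
  rw [← Finsupp.range_linearCombination, LinearMap.coe_range, hd.closure_range] at hspan
  exact TopologicalSpace.isSeparable_univ_iff.1 hspan

theorem IsCornerBounded.exists_isStinespringRep [CompleteSpace H] (h : IsCornerBounded p q Φ)
    (hA : Dense (A : Set B)) (hΦ : IsCompletelyPositive Φ) (hq : ∀ k ξ, q k ξ ∈ X) :
    ∃ (K : Type (max u v)) (_ : NormedAddCommGroup K) (_ : InnerProductSpace ℂ K)
      (_ : CompleteSpace K) (π : A →⋆ₙₐ[ℂ] (K →L[ℂ] K)) (V : X →ₗ[ℂ] K),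
      IsStinespringRep q Φ π V ∧ LinearPMap.IsClosable (⟨X, V⟩ : H →ₗ.[ℂ] K) ∧
      (TopologicalSpace.SeparableSpace B → TopologicalSpace.SeparableSpace H →
        TopologicalSpace.SeparableSpace K) := by
  obtain ⟨K, i₁, i₂, i₃, j, hj, hd⟩ :=
    exists_family_of_posSemidef (stinespringKernel Φ) hΦ.kernel_nonneg
  obtain ⟨π, hπ, hπj⟩ := h.exists_rep hd hj
  obtain ⟨V, hV, hVb⟩ := h.exists_operator hA hd hj
  have hπV : ∀ a ξ, π a (V ξ) = j (a, ξ) := fun a ξ => by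
    refine eq_of_inner_family_eq hd fun s => ?_
    -- `⟪π(a) Vξ, j s⟫ = ⟪Vξ, π(a*) j s⟫ = ⟪ξ, Φ(a* s.1) s.2⟫ = ⟪j (a, ξ), j s⟫`.
    rw [← ContinuousLinearMap.adjoint_inner_right, ← ContinuousLinearMap.star_eq_adjoint,
      ← map_star, hπj, hV, hj]
    rfl
  refine ⟨K, i₁, i₂, i₃, π, V, ⟨⟨1, fun a => by simpa using hπ a⟩, hVb, fun a ξ η => ?_⟩,
    isClosable_of_inner_eq hd hV, fun _ _ => separableSpace_of_rep h.exists_fixed hq hd hπ hVb hπV⟩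
  rw [hπV, hV]

/-- For `b` in the corner, both `ζ = Φ(b) ξ` and the vector `q k ξ` that may replace `ξ` lie in the
range of `q k`, where `V` is bounded. Estimating `⟪ζ, ζ⟫ = ⟪Vζ, π(b) V q k ξ⟫` and cancelling one
factor `‖ζ‖` gives the bound. -/
theorem IsStinespringRep.isBoundedOnCorner [CompleteSpace K] {π : A →⋆ₙₐ[ℂ] (K →L[ℂ] K)} {V : X →ₗ[ℂ] K}
    (h : IsStinespringRep q Φ π V) (hq : ∀ k ξ, q k ξ ∈ X) {k : ℕ}
    (hΦ : ∀ a b : A, (b : B) = rightMul (leftMul (p k) (a : B)) (p k) → ∀ ξ : X,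
      (Φ b ξ : H) ∈ Set.range (q k) ∧ Φ b ξ = Φ b ⟨q k ξ, hq k ξ⟩) :
    IsBoundedOnCorner Φ (p k) := by
  obtain ⟨C, hC⟩ := h.bounded_rep
  obtain ⟨D, hD⟩ := h.bounded_on_range k
  refine ⟨|D| * (|C| * (|D| * ‖q k‖)), fun a b hb ξ => ?_⟩
  obtain ⟨h1, h2⟩ := hΦ a b hb ξ
  set ζ := Φ b ξ
  rcases eq_or_ne ‖ζ‖ 0 with h0 | h0
  · rw [h0]; positivity
  have hinner := h.inner_eq b ⟨q k ξ, hq k ξ⟩ ζ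
  rw [← h2] at hinner
  have hle : ‖ζ‖ * ‖ζ‖ ≤ ‖ζ‖ * (|D| * (|C| * (|D| * ‖q k‖)) * ‖(b : B)‖ * ‖ξ‖) := by
    calc ‖ζ‖ * ‖ζ‖ = ‖⟪ζ, ζ⟫_ℂ‖ := by rw [inner_self_eq_norm_sq_to_K]; simp [sq]
      _ ≤ ‖V ζ‖ * (‖π b‖ * ‖V ⟨q k ξ, hq k ξ⟩‖) := by
          rw [hinner]
          refine (norm_inner_le_norm _ _).trans ?_
          gcongr
          exact (π b).le_opNorm _
      _ ≤ (|D| * ‖ζ‖) * ((|C| * ‖(b : B)‖) * (|D| * (‖q k‖ * ‖ξ‖))) := by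
          gcongr
          · exact (hD ζ h1).trans (by gcongr; exact le_abs_self D)
          · exact (hC b).trans (by gcongr; exact le_abs_self C)
          · refine (hD _ ⟨ξ, rfl⟩).trans ?_
            gcongr
            · exact le_abs_self D
            · exact (q k).le_opNorm ξ
      _ = _ := by ring
  exact le_of_mul_le_mul_left hle (lt_of_le_of_ne (norm_nonneg _) h0.symm)

end Theorem

end UnboundedStinespring

open UnboundedStinespring in
theorem theorem2p1
    {B : Type u} [NonUnitalCStarAlgebra B]
    (A : NonUnitalStarSubalgebra ℂ B) (hA : Dense (A : Set B))
    (p : ℕ → 𝓜(ℂ, B)) (hp : IsIncreasingProjections p)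
    (hpA : ∀ n, ∀ a ∈ A, leftMul (p n) a ∈ A)
    (hAp : ∀ n, ∀ a ∈ A, rightMul a (p n) ∈ A)
    (hAunion : (A : Set B) = ⋃ k, (fun a => rightMul (leftMul (p k) a) (p k)) '' (A : Set B))
    {H : Type v} [NormedAddCommGroup H] [InnerProductSpace ℂ H] [CompleteSpace H]
    (q : ℕ → (H →L[ℂ] H)) (hq : IsIncreasingProjections q)
    (hqlim : ∀ ξ : H, Tendsto (fun k => q k ξ) atTop (𝓝 ξ))
    (X : Submodule ℂ H) (hX : (X : Set H) = ⋃ k, Set.range (q k))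
    (Φ : A →ₗ[ℂ] (X →ₗ[ℂ] X)) (hΦ : IsCompletelyPositive Φ)
    (hcomp : ∀ (k m : ℕ) (a : A) (ξ : X),
      ((Φ ⟨rightMul (leftMul (p k) (a : B)) (p m), hAp m _ (hpA k _ a.2)⟩ ξ : X) : H) =
        q k (Φ a ⟨q m ξ, hX.ge (Set.mem_iUnion.2 ⟨m, (ξ : H), rfl⟩)⟩)) :
    ((∀ k, IsBoundedOnCorner Φ (p k)) ↔
      ∃ (K : Type (max u v)) (_ : NormedAddCommGroup K) (_ : InnerProductSpace ℂ K)
        (_ : CompleteSpace K) (π : A →⋆ₙₐ[ℂ] (K →L[ℂ] K)) (V : X →ₗ[ℂ] K),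
        IsStinespringRep q Φ π V) ∧
    ((∀ k, IsBoundedOnCorner Φ (p k)) →
      ∃ (K : Type (max u v)) (_ : NormedAddCommGroup K) (_ : InnerProductSpace ℂ K)
        (_ : CompleteSpace K) (π : A →⋆ₙₐ[ℂ] (K →L[ℂ] K)) (V : X →ₗ[ℂ] K),
        IsStinespringRep q Φ π V ∧ LinearPMap.IsClosable (⟨X, V⟩ : H →ₗ.[ℂ] K) ∧
        (TopologicalSpace.SeparableSpace B → TopologicalSpace.SeparableSpace H →
          TopologicalSpace.SeparableSpace K)) := by
  have hidem : ∀ k (x : H), q k (q k x) = q k x := fun k x =>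
    congrArg (fun T : H →L[ℂ] H => T x) (hq.isStarProjection k).isIdempotentElem.eq
  have hqX : ∀ k x, q k x ∈ X := fun k x => hX.ge (Set.mem_iUnion.2 ⟨k, x, rfl⟩)
  have hfix : ∀ ξ : X, ∃ k, ∀ m, k ≤ m → q m ξ = ξ := fun ξ => by
    obtain ⟨k, x, hx⟩ := Set.mem_iUnion.1 (hX.le ξ.2)
    refine ⟨k, fun m hm => ?_⟩
    rw [← hx]
    exact congrArg (fun T : H →L[ℂ] H => T x) (hq.mul_eq' hm)
  have hcorner : ∀ a : A, ∃ k, ∀ m, k ≤ m → InCorner (p m) (a : B) := fun a => by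
    obtain ⟨k, x, -, hx⟩ := Set.mem_iUnion.1 (hAunion.le a.2)
    exact ⟨k, fun m hm => hx ▸ inCorner_of_le hp hm x⟩
  have hcomp' : ∀ (k m : ℕ) (a b : A), (b : B) = rightMul (leftMul (p k) (a : B)) (p m) →
      ∀ ξ : X, (Φ b ξ : H) = q k (Φ a ⟨q m ξ, hqX m ξ⟩) := fun k m a b hb ξ => by
    obtain rfl : b = ⟨_, hAp m _ (hpA k _ a.2)⟩ := Subtype.ext hb
    exact hcomp k m a ξ
  have hforward : (∀ k, IsBoundedOnCorner Φ (p k)) → IsCornerBounded p q Φ := fun hbd =>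
    { isIncreasing := hp
      isStarProjection := hq.isStarProjection
      leftMul_mem := hpA
      rightMul_mem := hAp
      exists_inCorner := hcorner
      exists_fixed := fun ξ => (hfix ξ).imp fun k hk => hk k le_rfl
      apply_leftMul := fun k a a' ha' ξ => by
        -- For large `m` the right cutoffs are invisible, as `a p m = a` and `q m ξ = ξ`. The
        -- two-sided compatibility then reduces to the left one.
        obtain ⟨m₁, hm₁⟩ := hcorner a
        obtain ⟨m₂, hm₂⟩ := hfix ξ
        have h1 := (hm₁ (max m₁ m₂) (le_max_left _ _)).2
        have h2 := hm₂ (max m₁ m₂) (le_max_right _ _)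
        rw [hcomp' k (max m₁ m₂) a a' (by rw [rightMul_leftMul, h1, ha'])]
        congr 3
        exact Subtype.ext h2
      exists_bound := fun k => by
        obtain ⟨C, hC⟩ := hbd k
        refine ⟨|C|, abs_nonneg C, fun b hb ξ => (hC b b (by rw [hb.1, hb.2]) ξ).trans ?_⟩
        gcongr
        exact le_abs_self C }
  refine ⟨⟨fun hbd => ?_, ?_⟩, fun hbd => (hforward hbd).exists_isStinespringRep hA hΦ hqX⟩
  · obtain ⟨K, i₁, i₂, i₃, π, V, h, -⟩ := (hforward hbd).exists_isStinespringRep hA hΦ hqX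
    exact ⟨K, i₁, i₂, i₃, π, V, h⟩
  · rintro ⟨K, i₁, i₂, i₃, π, V, h⟩ k
    refine h.isBoundedOnCorner hqX fun a b hb ξ => ⟨⟨_, (hcomp' k k a b hb ξ).symm⟩, ?_⟩
    refine Subtype.ext ?_
    rw [hcomp' k k a b hb, hcomp' k k a b hb]
    congr 3
    exact Subtype.ext (hidem k _).symm
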